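/- Let $k$ be an algebraically closed field of characteristic $0$, and let $(R,\mathfrak m_R)$ be a complete Noetherian local $k$-algebra which is a one-dimensional domain with residue field $R/\mathfrak m_R = k$. Assume that $R$ is Gorenstein, i.e. that $R$ has finite injective dimension as a module over itself, and that its embedding dimension $n=\operatorname{edim}R$ (the minimal number of generators of $\mathfrak m_R$) satisfies $n\ge 6$. Let $x_1\in\mathfrak m_R$ generate a minimal reduction of $\mathfrak m_R$, i.e. $x_1R$ is minimal with respect to inclusion among the ideals $J\subseteq\mathfrak m_R$ with $J\,\mathfrak m_R^r=\mathfrak m_R^{r+1}$ for some $r\ge 0$. Then $R$ is a quotient of $k[[X_1,\dots,X_n]]$. For any surjective $k$-algebra homomorphism $\Phi:k[[X_1,\dots,X_n]]\to R$ with kernel $I=(f_1,\dots,f_m)$, let $$\Omega_R=\operatorname{coker}\Big(R^m\xrightarrow{\;[\Phi(\partial f_j/\partial X_i)]\;}R^n\Big)$$ be the universally finite module of differentials of $R$ over $k$, and let $\tau(\Omega_R)$ be its torsion submodule. If $\mathfrak m_R^6\subseteq x_1R$, then $\tau(\Omega_R)\ne 0$. -/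

import Mathlib

namespace Berger

open CategoryTheory

universe u v

/-- `J` is a reduction of the ideal `I`: `J ⊆ I` and `J I^r = I^(r+1)` for some `r`. -/
def IsReduction {R : Type v} [CommRing R] (J I : Ideal R) : Prop :=
  J ≤ I ∧ ∃ r : ℕ, J * I ^ r = I ^ (r + 1)

/-- `J` is a minimal reduction of `I`: a reduction of `I` that is minimal under inclusion. -/
def IsMinimalReduction {R : Type v} [CommRing R] (J I : Ideal R) : Prop :=
  Minimal (fun J' : Ideal R => IsReduction J' I) J

/-- The Gorenstein property of a Noetherian local ring: `R` has finite injective dimension as a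
module over itself. -/
def IsGorensteinLocal (R : Type v) [CommRing R] [IsLocalRing R] [IsNoetherianRing R] : Prop :=
  injectiveDimension (ModuleCat.of R R) < ⊤

section Differentials

variable {k : Type u} [Field k] {R : Type v} [CommRing R] [Algebra k R] {n : ℕ}

/-- The image `(Φ(∂f/∂X₁), …, Φ(∂f/∂Xₙ))` in `R^n` of the gradient of a power series `f`. -/
noncomputable def gradient (Φ : MvPowerSeries (Fin n) k →ₐ[k] R) (f : MvPowerSeries (Fin n) k) :
    Fin n → R :=
  fun i => Φ (MvPowerSeries.pderiv k i f)

/-- The submodule of `R^n` spanned by the gradients of the elements of `I = ker Φ`. It is the image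
of the Jacobian matrix of any system of generators of `I`, see `jacobianSubmodule_eq_span`. -/
noncomputable def jacobianSubmodule (Φ : MvPowerSeries (Fin n) k →ₐ[k] R) :
    Submodule R (Fin n → R) :=
  Submodule.span R (gradient Φ '' (RingHom.ker Φ : Set (MvPowerSeries (Fin n) k)))

/-- The universally finite module of differentials of `R` over `k`, for a presentation
`Φ : k⟦X₁, …, Xₙ⟧ ↠ R`: the cokernel of the Jacobian matrix of `ker Φ`. -/
abbrev UnivFiniteDifferentials (Φ : MvPowerSeries (Fin n) k →ₐ[k] R) : Type v :=
  (Fin n → R) ⧸ jacobianSubmodule Φ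

/-- The Jacobian submodule is spanned by the gradients of any system of generators of `ker Φ`. -/
theorem jacobianSubmodule_eq_span (Φ : MvPowerSeries (Fin n) k →ₐ[k] R)
    (F : Set (MvPowerSeries (Fin n) k)) (hF : Ideal.span F = RingHom.ker Φ) :
    jacobianSubmodule Φ = Submodule.span R (gradient Φ '' F) := by
  apply le_antisymm
  · refine Submodule.span_le.2 ?_
    rintro _ ⟨f, hf, rfl⟩
    have hf' : f ∈ Ideal.span F := by rw [hF]; exact hf
    refine Submodule.span_induction (p := fun f _ => gradient Φ f ∈ Submodule.span R
      (gradient Φ '' F)) ?_ ?_ ?_ ?_ hf'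
    · exact fun g hg => Submodule.subset_span ⟨g, hg, rfl⟩
    · have h : gradient Φ 0 = 0 := by ext i; simp [gradient]
      rw [h]; exact zero_mem _
    · intro g h _ _ hg hh
      have e : gradient Φ (g + h) = gradient Φ g + gradient Φ h := by ext i; simp [gradient]
      rw [e]; exact add_mem hg hh
    · intro a g hgF hg
      have h0 : Φ g = 0 := hF.le hgF
      have e : gradient Φ (a • g) = Φ a • gradient Φ g := by
        ext i; simp [gradient, Derivation.leibniz, h0]
      rw [e]; exact Submodule.smul_mem _ _ hg
  · refine Submodule.span_mono (Set.image_mono ?_)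
    intro g hg
    change g ∈ RingHom.ker Φ
    rw [← hF]; exact Ideal.subset_span hg

end Differentials

end Berger

/-!
Put `A = R ⧸ x` and write `𝔪` for its maximal ideal. If `Ω_R` were torsion-free, multiplication by
`x` on `Ω_R` could be compared with multiplication by `x` on `R · dx`: the cokernel of
`R → Ω_R`, `1 ↦ dx`, has finite length because `R` is integral over `k⟦x⟧`, on which `d` vanishes
modulo `dx`. Hence `dim Ω_R ⧸ x ≤ dim A`, and `Ω_R ⧸ x` surjects onto `Ω_A`.

On the other side, `A` is an Artinian Gorenstein algebra with `𝔪 ^ 6 = 0` and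
`h = dim 𝔪 ⧸ 𝔪 ^ 2 ≥ n - 1 ≥ 5`. Sending `a db` to the wedge product of the linear parts of `a` and
`b` maps `Ω_A` onto `⋀² (𝔪 ⧸ 𝔪 ^ 2)` and kills exact differentials, while Euler's formula gives
`ker d ⊆ k + 𝔪 ^ 4`. Duality gives `dim 𝔪 ^ 4 ≤ dim A - dim 𝔪 ^ 2 = h + 1`, and therefore
`dim Ω_A ≥ h.choose 2 + dim A - 1 - (h + 1) > dim A`, a contradiction.
-/

namespace Berger

section Length

variable {S M V : Type*} [Ring S] [AddCommGroup M] [Module S M] [AddCommGroup V] [Module S V]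

theorem length_quotient_eq_add (g : M →ₗ[S] V) (N : Submodule S V) :
    Module.length S (V ⧸ N) =
      Module.length S (M ⧸ N.comap g) + Module.length S (V ⧸ (LinearMap.range g ⊔ N)) := by
  refine Module.length_eq_add_of_exact ((N.comap g).mapQ N g le_rfl)
    (Submodule.factor le_sup_right) ?_ (Submodule.factor_surjective _) ?_
  · rw [← LinearMap.ker_eq_bot, Submodule.ker_mapQ, Submodule.mkQ_map_self]
  · rw [LinearMap.exact_iff, Submodule.factor, Submodule.ker_mapQ, Submodule.comap_id,
      Submodule.range_mapQ, Submodule.map_sup, Submodule.mkQ_map_self, sup_bot_eq]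

theorem length_quotient_range_le {f : V →ₗ[S] V} (hf : Function.Injective f) {f' : M →ₗ[S] M}
    (g : M →ₗ[S] V) (hfg : f ∘ₗ g = g ∘ₗ f')
    (hg : Module.length S (V ⧸ LinearMap.range g) ≠ ⊤) :
    Module.length S (V ⧸ LinearMap.range f) ≤ Module.length S (M ⧸ LinearMap.range f') := by
  set N := LinearMap.range (g ∘ₗ f')
  have hNf : N ≤ LinearMap.range f :=
    (congrArg LinearMap.range hfg.symm).trans_le (LinearMap.range_comp_le_range g f)
  have hNg : N ≤ LinearMap.range g := LinearMap.range_comp_le_range f' g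
  have hcomap : N.comap f = LinearMap.range g := by
    rw [show N = (LinearMap.range g).map f by rw [← LinearMap.range_comp, hfg],
      Submodule.comap_map_eq_of_injective hf]
  have hle : LinearMap.range f' ≤ N.comap g := by
    rw [← Submodule.map_le_iff_le_comap, ← LinearMap.range_comp]
  have key := (length_quotient_eq_add f N).symm.trans (length_quotient_eq_add g N)
  rw [hcomap, sup_of_le_left hNf, sup_of_le_left hNg, add_comm] at key
  rw [ENat.add_left_injective_of_ne_top hg key]
  exact Module.length_le_of_surjective (Submodule.factor hle) (Submodule.factor_surjective hle)

end Length

section Derivation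

theorem mvPowerSeries_mem_span_range_X {k σ : Type*} [CommRing k] [Finite σ]
    {f : MvPowerSeries σ k} (hf : MvPowerSeries.constantCoeff f = 0) :
    f ∈ Ideal.span (Set.range MvPowerSeries.X) := by
  classical
  have := Fintype.ofFinite σ
  -- `v d` is a variable dividing the monomial `d`; `part i` collects the monomials with `v d = i`.
  choose v hv using fun (d : σ →₀ ℕ) (hd : d ≠ 0) => Finsupp.ne_iff.1 hd
  let part (i : σ) : MvPowerSeries σ k :=
    fun d => if h : d = 0 then 0 else if v d h = i then MvPowerSeries.coeff d f else 0
  have hcoeff (i : σ) (d : σ →₀ ℕ) : MvPowerSeries.coeff d (part i) =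
      if h : d = 0 then 0 else if v d h = i then MvPowerSeries.coeff d f else 0 := rfl
  have hsum : ∑ i, part i = f := by
    ext d
    rw [map_sum]
    simp only [hcoeff]
    by_cases hd : d = 0
    · simp [hd, hf]
    · simp [hd]
  rw [← hsum]
  refine sum_mem fun i _ => Ideal.mem_of_dvd _ (MvPowerSeries.X_dvd_iff.2 fun d hdi => ?_)
    (Ideal.subset_span ⟨i, rfl⟩)
  rw [hcoeff]
  split_ifs with hd hvi
  · rfl
  · exact absurd (hvi ▸ hdi) (hv d hd)
  · rfl

theorem derivation_mvPowerSeries_ext {k σ M : Type*} [CommRing k] [Finite σ] [AddCommGroup M]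
    [Module k M] [Module (MvPowerSeries σ k) M]
    [IsHausdorff (Ideal.span (Set.range (MvPowerSeries.X (R := k) (σ := σ)))) M]
    {D₁ D₂ : Derivation k (MvPowerSeries σ k) M}
    (h : ∀ i, D₁ (MvPowerSeries.X i) = D₂ (MvPowerSeries.X i)) : D₁ = D₂ := by
  have := Fintype.ofFinite σ
  set I : Ideal (MvPowerSeries σ k) := Ideal.span (Set.range MvPowerSeries.X)
  have hmem : ∀ j f, D₁ f - D₂ f ∈ I ^ j • (⊤ : Submodule (MvPowerSeries σ k) M) := by
    intro j
    induction j with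
    | zero => simp
    | succ j ih =>
      intro f
      set c := algebraMap k (MvPowerSeries σ k) (MvPowerSeries.constantCoeff f)
      obtain ⟨g, hg⟩ := (Submodule.mem_span_range_iff_exists_fun _).1
        (mvPowerSeries_mem_span_range_X (f := f - c) (by simp [c, MvPowerSeries.algebraMap_apply]))
      have hD (D : Derivation k (MvPowerSeries σ k) M) :
          D f = ∑ i, (g i • D (MvPowerSeries.X i) +
            (MvPowerSeries.X i : MvPowerSeries σ k) • D (g i)) := by
        rw [← sub_add_cancel f c, map_add, D.map_algebraMap, add_zero, ← hg, map_sum]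
        simp only [smul_eq_mul, Derivation.leibniz]
      rw [hD, hD, ← Finset.sum_sub_distrib]
      refine sum_mem fun i _ => ?_
      rw [h, add_sub_add_left_eq_sub, ← smul_sub, pow_succ', ← smul_eq_mul, Submodule.smul_assoc]
      exact Submodule.smul_mem_smul (Ideal.subset_span ⟨i, rfl⟩) (ih (g i))
  ext f
  exact IsHausdorff.eq_iff_smodEq (I := I) |>.2 fun j => SModEq.sub_mem.2 (hmem j f)

open Polynomial in
theorem exists_smul_derivation_eq_zero {S R M : Type*} [CommRing S] [CommRing R] [IsDomain R]
    [CharZero R] [Algebra S R] [Algebra.IsIntegral S R] [AddCommGroup M] [Module S M] [Module R M]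
    (D : Derivation S R M) (r : R) : ∃ c : R, c ≠ 0 ∧ c • D r = 0 := by
  -- Otherwise `p(r) = 0` gives `p'(r) • D r = 0`, hence `p'(r) = 0`, and the degree can drop.
  by_contra! hD
  have hann (p : S[X]) (hp : aeval r p = 0) : p.map (algebraMap S R) = 0 := by
    induction hn : p.natDegree using Nat.strong_induction_on generalizing p with | _ n ih
    have hp' : aeval r (derivative p) = 0 := by
      by_contra hc
      exact hD _ hc (by rw [← D.map_aeval, hp, map_zero])
    have hconst : (p.map (algebraMap S R)).natDegree = 0 := by
      rcases eq_or_ne p.natDegree 0 with h0 | h0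
      · exact Nat.le_zero.1 (h0 ▸ natDegree_map_le)
      · refine derivative_eq_zero.1 ?_
        rw [derivative_map, ih _ (hn ▸ natDegree_derivative_lt h0) _ hp' rfl]
    obtain ⟨c, hc⟩ := natDegree_eq_zero.1 hconst
    rw [← eval_map_algebraMap, ← hc, eval_C] at hp
    rw [← hc, hp, C_0]
  obtain ⟨p, hmonic, hp⟩ := Algebra.IsIntegral.isIntegral (R := S) r
  exact (hmonic.map (algebraMap S R)).ne_zero (hann p hp)

end Derivation

section Completeness

variable {P M : Type*} [CommRing P] [AddCommGroup M] [Module P M] (I : Ideal P) [IsPrecomplete I P]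

theorem isPrecomplete_of_finite [Module.Finite P M] : IsPrecomplete I M := by
  rw [← AdicCompletion.of_surjective_iff]
  intro z
  obtain ⟨t, rfl⟩ := AdicCompletion.ofTensorProduct_surjective_of_finite I M z
  induction t with
  | zero => exact ⟨0, by simp⟩
  | add s t hs ht =>
    obtain ⟨⟨m, hm⟩, m', hm'⟩ := hs, ht
    exact ⟨m + m', by rw [map_add, map_add, hm, hm']⟩
  | tmul a m =>
    obtain ⟨p, rfl⟩ := AdicCompletion.of_surjective I P a
    refine ⟨p • m, ?_⟩
    rw [AdicCompletion.ofTensorProduct_tmul]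
    exact AdicCompletion.ext fun _ => rfl

theorem finite_of_finite_quotient_smul_top [IsHausdorff I M]
    [Module.Finite P (M ⧸ (I • ⊤ : Submodule P M))] : Module.Finite P M := by
  obtain ⟨d, f, hf⟩ := Module.Finite.exists_fin' P (M ⧸ (I • ⊤ : Submodule P M))
  obtain ⟨g, rfl⟩ := Module.projective_lifting_property _ f (Submodule.mkQ_surjective _)
  have := isPrecomplete_of_finite (M := Fin d → P) I
  exact .of_surjective g (surjective_of_mkQ_comp_surjective hf)

end Completeness

section Evaluation

open MvPowerSeries

variable {k : Type*} [CommRing k] {R : Type*} [CommRing R] [Algebra k R] {σ : Type*} [Finite σ]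

theorem exists_mvPowerSeries_algHom {I : Ideal R} [IsAdicComplete I R] {y : σ → R}
    (hy : ∀ i, y i ∈ I) : ∃ Φ : MvPowerSeries σ k →ₐ[k] R, ∀ i, Φ (X i) = y i := by
  let : WithIdeal R := ⟨I⟩
  obtain ⟨_, _⟩ := (IsAdic.isAdicComplete_iff (R := R) (I := I) rfl).1 inferInstance
  let : UniformSpace k := ⊥
  have : DiscreteTopology k := ⟨rfl⟩
  have : ContinuousSMul k R := DiscreteTopology.instContinuousSMul k R
  have ha : HasEval y := by
    refine ⟨fun s => ?_, by simp [Filter.cofinite_eq_bot]⟩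
    refine (Ideal.hasBasis_nhds_zero_adic I).tendsto_right_iff.2 fun j _ => ?_
    filter_upwards [Filter.eventually_ge_atTop j] with m hm
    exact Ideal.pow_le_pow_right hm (Ideal.pow_mem_pow (hy s) m)
  refine ⟨aeval ha, fun i => ?_⟩
  rw [← MvPolynomial.coe_X, aeval_coe, MvPolynomial.aeval_X]

theorem mvPowerSeries_algHom_surjective {I : Ideal R} [IsHausdorff I R]
    (hI : ∀ r, ∃ c : k, r - algebraMap k R c ∈ I) {Φ : MvPowerSeries σ k →ₐ[k] R}
    (hΦ : Ideal.span (Set.range fun i => Φ (X i)) = I) : Function.Surjective Φ := by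
  have hmap : (Ideal.span (Set.range X)).map (Φ : MvPowerSeries σ k →+* R) = I := by
    rw [Ideal.map_span, ← Set.range_comp]
    exact hΦ
  have : IsHausdorff ((Ideal.span (Set.range X)).map (Φ : MvPowerSeries σ k →+* R)) R := by
    rwa [hmap]
  refine surjective_of_mk_map_comp_surjective (I := Ideal.span (Set.range X))
    (Φ : MvPowerSeries σ k →+* R) fun r => ?_
  obtain ⟨r, rfl⟩ := Ideal.Quotient.mk_surjective r
  obtain ⟨c, hc⟩ := hI r
  refine ⟨algebraMap k _ c, (Ideal.Quotient.eq.2 ?_).symm⟩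
  simpa [hmap] using hc

end Evaluation

section FiniteLength

theorem krullDimLE_one_of_maximalIdeal_pow_le_span_singleton {R : Type*} [CommRing R]
    [IsLocalRing R] [IsNoetherianRing R] {x : R} (hx : x ∈ IsLocalRing.maximalIdeal R) {j : ℕ}
    (hj : IsLocalRing.maximalIdeal R ^ j ≤ Ideal.span {x}) : Ring.KrullDimLE 1 R := by
  rw [Ring.krullDimLE_iff, ← IsLocalRing.maximalIdeal_height_eq_ringKrullDim]
  have hmin : IsLocalRing.maximalIdeal R ∈ (Ideal.span {x}).minimalPrimes :=
    ⟨⟨inferInstance, (Ideal.span_singleton_le_iff_mem _).2 hx⟩,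
      fun p ⟨_, hxp⟩ _ => Ideal.IsPrime.le_of_pow_le (hj.trans hxp)⟩
  exact_mod_cast Ideal.height_le_one_of_isPrincipal_of_mem_minimalPrimes (Ideal.span {x}) _ hmin

theorem isFiniteLength_of_finite_of_isTorsion {R M : Type*} [CommRing R] [IsNoetherianRing R]
    [Ring.KrullDimLE 1 R] [AddCommGroup M] [Module R M] [Module.Finite R M]
    (hM : Module.IsTorsion R M) : IsFiniteLength R M := by
  obtain ⟨c, hcM, hc⟩ := Submodule.annihilator_top_inter_nonZeroDivisors hM
  obtain ⟨_, _⟩ := isFiniteLength_iff_isNoetherian_isArtinian.1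
    (isFiniteLength_quotient_span_singleton R hc)
  have : IsArtinianRing (R ⧸ Ideal.span {c}) :=
    isArtinian_of_tower R ‹IsArtinian R (R ⧸ Ideal.span {c})›
  have hcM' : Module.IsTorsionBySet R M (Ideal.span {c}) :=
    (Module.isTorsionBySet_span_singleton_iff c).2 fun m =>
      Submodule.mem_annihilator.1 hcM m trivial
  let := hcM'.module
  have : Module.Finite (R ⧸ Ideal.span {c}) M := .of_restrictScalars_finite R _ _
  have : IsArtinian R M :=
    isArtinian_of_surjective_algebraMap (R := R ⧸ Ideal.span {c}) Ideal.Quotient.mk_surjective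
  exact isFiniteLength_iff_isNoetherian_isArtinian.2 ⟨inferInstance, inferInstance⟩

theorem finite_of_isFiniteLength (k : Type*) {R M : Type*} [Field k] [CommRing R] [IsLocalRing R]
    [Algebra k R] [hres : Module.Finite k (IsLocalRing.ResidueField R)] [AddCommGroup M]
    [Module R M] [hk : Module k M] [IsScalarTower k R M] (hM : IsFiniteLength R M) :
    Module.Finite k M := by
  revert hk
  induction hM with
  | of_subsingleton => intros; infer_instance
  | @of_simple_quotient M _ _ N hN _ ih =>
    intro _ _
    obtain ⟨J, hJ, ⟨e⟩⟩ := isSimpleModule_iff_quot_maximal.1 hN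
    obtain rfl := IsLocalRing.eq_maximalIdeal hJ
    have : Module.Finite k (N.restrictScalars k) := ih
    have : Module.Finite k (R ⧸ IsLocalRing.maximalIdeal R) := hres
    have : Module.Finite k (M ⧸ N.restrictScalars k) :=
      .equiv ((e.restrictScalars k).symm.trans (Submodule.Quotient.restrictScalarsEquiv k N).symm)
    exact .of_submodule_quotient (N.restrictScalars k)

end FiniteLength

section Parameter

theorem isTorsion_of_derivation_comp_algebraMap_eq_zero {k S R M : Type*} [CommRing k] [CommRing S]
    [CommRing R] [IsDomain R] [CharZero R] [Algebra k R] [Algebra S R] [Algebra.IsIntegral S R]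
    [AddCommGroup M] [Module k M] [Module R M] (d : Derivation k R M)
    (hd : Submodule.span R (Set.range d) = ⊤) (hS : ∀ s, d (algebraMap S R s) = 0) :
    Module.IsTorsion R M := by
  let := Module.compHom M (algebraMap S R)
  have : IsScalarTower S R M := .of_algebraMap_smul fun _ _ => rfl
  let D : Derivation S R M := .mk'
    { toFun := d
      map_add' := map_add d
      map_smul' := fun s r => by simp [Algebra.smul_def, hS] }
    d.leibniz
  have htop : Submodule.torsion R M = ⊤ := by
    rw [eq_top_iff, ← hd, Submodule.span_le]
    rintro _ ⟨r, rfl⟩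
    obtain ⟨c, hc, hcr⟩ := exists_smul_derivation_eq_zero D r
    exact ⟨⟨c, mem_nonZeroDivisors_of_ne_zero hc⟩, hcr⟩
  intro m
  exact (Submodule.mem_torsion_iff m).1 (htop ▸ trivial)

open MvPowerSeries

theorem exists_mvPowerSeries_algHom_finite {k R : Type*} [CommRing k] [CommRing R]
    [Algebra k R] {I : Ideal R} [IsAdicComplete I R] {x : R} (hx : x ∈ I)
    [Module.Finite k (R ⧸ Ideal.span {x})] :
    ∃ φ : MvPowerSeries Unit k →ₐ[k] R, φ (X ()) = x ∧ (φ : MvPowerSeries Unit k →+* R).Finite := by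
  obtain ⟨φ, hφ⟩ := exists_mvPowerSeries_algHom (k := k) (σ := Unit) fun _ => hx
  refine ⟨φ, hφ (), ?_⟩
  let := (φ : MvPowerSeries Unit k →+* R).toAlgebra
  have : IsScalarTower k (MvPowerSeries Unit k) R := .of_algebraMap_eq' φ.comp_algebraMap.symm
  let J : Ideal (MvPowerSeries Unit k) := Ideal.span (Set.range X)
  have hJ : J.map (algebraMap (MvPowerSeries Unit k) R) = Ideal.span {x} := by
    rw [Ideal.map_span, Set.range_unique, Set.image_singleton]
    exact congrArg (fun y => Ideal.span {y}) (hφ ())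
  have : IsHausdorff J R :=
    .of_map (J := I) (hJ.trans_le ((Ideal.span_singleton_le_iff_mem _).2 hx))
  have : Module.Finite k (R ⧸ (J • ⊤ : Submodule (MvPowerSeries Unit k) R)) := by
    rw [Ideal.smul_top_eq_map, hJ]
    exact .equiv ((Submodule.Quotient.restrictScalarsEquiv (MvPowerSeries Unit k)
      (Ideal.span {x})).restrictScalars k).symm
  have : Module.Finite (MvPowerSeries Unit k) (R ⧸ (J • ⊤ : Submodule (MvPowerSeries Unit k) R)) :=
    .of_restrictScalars_finite k _ _
  exact finite_of_finite_quotient_smul_top J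

variable {k R : Type*} [Field k] [CharZero k] [CommRing R] [IsDomain R] [IsLocalRing R]
  [IsNoetherianRing R] [Algebra k R] [Module.Finite k (IsLocalRing.ResidueField R)]
  [IsAdicComplete (IsLocalRing.maximalIdeal R) R] [Ring.KrullDimLE 1 R]
  {M : Type*} [AddCommGroup M] [Module R M] [Module k M] [Module.Finite R M]

theorem isTorsion_of_derivation_eq_zero (d : Derivation k R M)
    (hd : Submodule.span R (Set.range d) = ⊤) {x : R} (hx0 : x ≠ 0)
    (hx : x ∈ IsLocalRing.maximalIdeal R) (hdx : d x = 0) : Module.IsTorsion R M := by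
  have : Module.Finite k (R ⧸ Ideal.span {x}) := finite_of_isFiniteLength k
    (isFiniteLength_quotient_span_singleton R (mem_nonZeroDivisors_of_ne_zero hx0))
  obtain ⟨φ, hφx, hφ⟩ := exists_mvPowerSeries_algHom_finite (k := k) hx
  let := (φ : MvPowerSeries Unit k →+* R).toAlgebra
  let := Module.compHom M (φ : MvPowerSeries Unit k →+* R)
  have : IsScalarTower k (MvPowerSeries Unit k) R := .of_algebraMap_eq' φ.comp_algebraMap.symm
  have : IsScalarTower (MvPowerSeries Unit k) R M := .of_algebraMap_smul fun _ _ => rfl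
  have : Module.Finite (MvPowerSeries Unit k) R := hφ
  have : CharZero R := charZero_of_injective_algebraMap (algebraMap k R).injective
  have : IsHausdorff (Ideal.span (Set.range (X (R := k) (σ := Unit)))) M := by
    refine .of_map (J := IsLocalRing.maximalIdeal R) ?_
    rw [Ideal.map_span, Set.range_unique, Set.image_singleton, Ideal.span_singleton_le_iff_mem]
    exact hφx ▸ hx
  have hd0 : d.compAlgebraMap (MvPowerSeries Unit k) = 0 :=
    derivation_mvPowerSeries_ext fun _ => (congrArg d hφx).trans hdx
  exact isTorsion_of_derivation_comp_algebraMap_eq_zero d hd (DFunLike.congr_fun hd0)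

theorem finite_quotient_span_derivation [IsScalarTower k R M] (d : Derivation k R M)
    (hd : Submodule.span R (Set.range d) = ⊤) {x : R} (hx0 : x ≠ 0)
    (hx : x ∈ IsLocalRing.maximalIdeal R) :
    Module.Finite k (M ⧸ Submodule.span R {d x}) := by
  refine finite_of_isFiniteLength k (isFiniteLength_of_finite_of_isTorsion (R := R)
    (isTorsion_of_derivation_eq_zero ((Submodule.mkQ _).compDer d) ?_ hx0 hx ?_))
  · exact (congrArg (Submodule.span R) (Set.range_comp (Submodule.mkQ _) d)).trans
      (by rw [Submodule.span_image, hd, Submodule.map_top, Submodule.range_mkQ])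
  · exact (Submodule.Quotient.mk_eq_zero _).2 (Submodule.mem_span_singleton_self _)

theorem length_quotSMulTop_le_of_derivation [IsScalarTower k R M] [Module.IsTorsionFree R M]
    (d : Derivation k R M) (hd : Submodule.span R (Set.range d) = ⊤) {x : R} (hx0 : x ≠ 0)
    (hx : x ∈ IsLocalRing.maximalIdeal R) :
    Module.length k (QuotSMulTop x M) ≤ Module.length k (R ⧸ Ideal.span {x}) := by
  have hcoker : Module.length k
      (M ⧸ LinearMap.range ((LinearMap.toSpanSingleton R M (d x)).restrictScalars k)) ≠ ⊤ := by
    have := finite_quotient_span_derivation d hd hx0 hx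
    rw [LinearMap.range_restrictScalars, LinearMap.range_toSpanSingleton,
      (Submodule.Quotient.restrictScalarsEquiv k _).length_eq, Module.length_eq_finrank]
    exact ENat.natCast_ne_top _
  have key := length_quotient_range_le (f := (LinearMap.lsmul R M x).restrictScalars k)
    (f' := (LinearMap.toSpanSingleton R R x).restrictScalars k) (smul_right_injective M hx0)
    ((LinearMap.toSpanSingleton R M (d x)).restrictScalars k)
    (LinearMap.ext fun r => (smul_smul x r (d x)).trans (by rw [mul_comm]; rfl)) hcoker
  rwa [LinearMap.range_restrictScalars, (Submodule.Quotient.restrictScalarsEquiv k _).length_eq,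
    LinearMap.range_restrictScalars, (Submodule.Quotient.restrictScalarsEquiv k _).length_eq,
    LinearMap.range_toSpanSingleton, LinearMap.range_eq_map] at key

end Parameter

section UnivFiniteDifferentials

open MvPowerSeries KaehlerDifferential

variable {k : Type*} [Field k] {R : Type*} [CommRing R] [Algebra k R] {n : ℕ}
  {Φ : MvPowerSeries (Fin n) k →ₐ[k] R}

theorem gradient_X (i : Fin n) : gradient Φ (X i) = Pi.single i 1 := by
  classical
  ext j
  rcases eq_or_ne j i with rfl | hij
  · simp [gradient]
  · simp [gradient, pderiv_X, hij]

theorem gradient_add (f g : MvPowerSeries (Fin n) k) :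
    gradient Φ (f + g) = gradient Φ f + gradient Φ g := by
  ext i
  simp [gradient]

theorem gradient_smul (c : k) (f : MvPowerSeries (Fin n) k) :
    gradient Φ (c • f) = c • gradient Φ f := by
  ext i
  simp [gradient]

theorem gradient_mul (f g : MvPowerSeries (Fin n) k) :
    gradient Φ (f * g) = Φ f • gradient Φ g + Φ g • gradient Φ f := by
  ext i
  simp [gradient]

theorem mk_gradient_eq_mk_gradient {f g : MvPowerSeries (Fin n) k} (hfg : Φ f = Φ g) :
    (Submodule.Quotient.mk (gradient Φ f) : UnivFiniteDifferentials Φ) =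
      Submodule.Quotient.mk (gradient Φ g) := by
  rw [← sub_add_cancel f g, gradient_add, Submodule.Quotient.mk_add, add_eq_right,
    Submodule.Quotient.mk_eq_zero]
  exact Submodule.subset_span ⟨f - g, by simp [RingHom.mem_ker, hfg], rfl⟩

/-- The universal finite derivation `R → UnivFiniteDifferentials Φ` of a presentation `Φ`: it sends
the class of a power series to the class of its gradient. -/
noncomputable def univDerivation (hΦ : Function.Surjective Φ) :
    Derivation k R (UnivFiniteDifferentials Φ) :=
  .mk'
    { toFun := fun r => Submodule.Quotient.mk (gradient Φ (Function.surjInv hΦ r))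
      map_add' := fun r s => by
        rw [← Submodule.Quotient.mk_add, ← gradient_add]
        exact mk_gradient_eq_mk_gradient (by simp [Function.surjInv_eq])
      map_smul' := fun c r => by
        rw [RingHom.id_apply, ← Submodule.Quotient.mk_smul, ← gradient_smul]
        exact mk_gradient_eq_mk_gradient (by simp [Function.surjInv_eq]) }
    fun r s => by
      refine (mk_gradient_eq_mk_gradient (g := Function.surjInv hΦ r * Function.surjInv hΦ s)
        (by simp [Function.surjInv_eq])).trans ?_
      simp [gradient_mul, Function.surjInv_eq]

theorem univDerivation_apply (hΦ : Function.Surjective Φ) (f : MvPowerSeries (Fin n) k) :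
    univDerivation hΦ (Φ f) = Submodule.Quotient.mk (gradient Φ f) :=
  mk_gradient_eq_mk_gradient (Function.surjInv_eq hΦ _)

theorem span_range_univDerivation (hΦ : Function.Surjective Φ) :
    Submodule.span R (Set.range (univDerivation hΦ)) = ⊤ := by
  rw [eq_top_iff, ← Submodule.range_mkQ, LinearMap.range_eq_map, ← (Pi.basisFun R (Fin n)).span_eq,
    Submodule.map_span_le]
  rintro _ ⟨i, rfl⟩
  refine Submodule.subset_span ⟨Φ (X i), ?_⟩
  rw [univDerivation_apply, gradient_X, Pi.basisFun_apply, Submodule.mkQ_apply]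

variable {M : Type*} [AddCommGroup M] [Module k M] [Module R M] [IsScalarTower k R M]
  {I : Ideal R} [IsHausdorff I M]

theorem derivation_apply_eq_sum_gradient_smul (hI : ∀ i, Φ (X i) ∈ I) (D : Derivation k R M)
    (f : MvPowerSeries (Fin n) k) : D (Φ f) = ∑ i, gradient Φ f i • D (Φ (X i)) := by
  let := (Φ : MvPowerSeries (Fin n) k →+* R).toAlgebra
  let := Module.compHom M (Φ : MvPowerSeries (Fin n) k →+* R)
  have : IsScalarTower k (MvPowerSeries (Fin n) k) R := .of_algebraMap_eq' Φ.comp_algebraMap.symm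
  have : IsScalarTower (MvPowerSeries (Fin n) k) R M := .of_algebraMap_smul fun _ _ => rfl
  have : IsScalarTower k (MvPowerSeries (Fin n) k) M := .of_algebraMap_smul fun c m =>
    (congrArg (· • m) (Φ.commutes c)).trans (algebraMap_smul R c m)
  have : IsHausdorff (Ideal.span (Set.range (X (R := k) (σ := Fin n)))) M := by
    refine .of_map (J := I) ?_
    rw [Ideal.map_span, Ideal.span_le]
    rintro _ ⟨_, ⟨i, rfl⟩, rfl⟩
    exact hI i
  let E : Derivation k (MvPowerSeries (Fin n) k) M := ∑ i,
    (LinearMap.toSpanSingleton (MvPowerSeries (Fin n) k) M (D (Φ (X i)))).compDer (pderiv k i)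
  have hE (f) : E f = ∑ i, gradient Φ f i • D (Φ (X i)) := by
    rw [show E f = Derivation.coeFnAddMonoidHom E f from rfl, map_sum, Finset.sum_apply]
    rfl
  have hEX (i) : E (X i) = D (Φ (X i)) := by simp [hE, gradient_X, Pi.single_apply]
  have hDE : D.compAlgebraMap (MvPowerSeries (Fin n) k) = E :=
    derivation_mvPowerSeries_ext fun i => (hEX i).symm
  exact (DFunLike.congr_fun hDE f).trans (hE f)

theorem exists_linearMap_univDerivation_eq (hΦ : Function.Surjective Φ) (hI : ∀ i, Φ (X i) ∈ I)
    (D : Derivation k R M) :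
    ∃ ℓ : UnivFiniteDifferentials Φ →ₗ[R] M, ∀ r, ℓ (univDerivation hΦ r) = D r := by
  have hD (f) : Fintype.linearCombination R (fun i => D (Φ (X i))) (gradient Φ f) = D (Φ f) :=
    (derivation_apply_eq_sum_gradient_smul hI D f).symm
  refine ⟨(jacobianSubmodule Φ).liftQ (Fintype.linearCombination R fun i => D (Φ (X i))) ?_,
    hΦ.forall.2 fun f => ?_⟩
  · rw [jacobianSubmodule, Submodule.span_le]
    rintro _ ⟨f, hf, rfl⟩
    exact (hD f).trans (by rw [RingHom.mem_ker.1 hf, map_zero])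
  · rw [univDerivation_apply, ← hD]
    exact Submodule.liftQ_apply _ _ _

theorem map_X_mem_maximalIdeal [IsLocalRing R] (hΦ : Function.Surjective Φ) (i : Fin n) :
    Φ (X i) ∈ IsLocalRing.maximalIdeal R := by
  have : IsLocalHom (Φ : MvPowerSeries (Fin n) k →+* R) := IsLocalHom.of_surjective _ hΦ
  intro hunit
  have h := ((isUnit_map_iff (Φ : MvPowerSeries (Fin n) k →+* R) (X i)).1 hunit).map constantCoeff
  rw [constantCoeff_X] at h
  exact not_isUnit_zero h

open Pointwise in
theorem length_kaehlerDifferential_le_length_quotSMulTop [IsLocalRing R] [IsNoetherianRing R]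
    (hΦ : Function.Surjective Φ) (x : R) [Module.Finite k (R ⧸ Ideal.span {x})] :
    Module.length k (Ω[(R ⧸ Ideal.span {x})⁄k]) ≤
      Module.length k (QuotSMulTop x (UnivFiniteDifferentials Φ)) := by
  have : Module.Finite R Ω[(R ⧸ Ideal.span {x})⁄k] := .trans (R ⧸ Ideal.span {x}) _
  obtain ⟨ℓ, hℓ⟩ := exists_linearMap_univDerivation_eq hΦ (map_X_mem_maximalIdeal hΦ)
    ((D k (R ⧸ Ideal.span {x})).compAlgebraMap R)
  have hx : x • (⊤ : Submodule R (UnivFiniteDifferentials Φ)) ≤ LinearMap.ker ℓ := by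
    rintro _ ⟨m, -, rfl⟩
    rw [LinearMap.mem_ker, DistribSMul.toLinearMap_apply, map_smul,
      ← algebraMap_smul (R ⧸ Ideal.span {x}), Ideal.Quotient.algebraMap_eq,
      Ideal.Quotient.eq_zero_iff_mem.2 (Ideal.mem_span_singleton_self x), zero_smul]
  have hℓ_surj : LinearMap.range ℓ = ⊤ := by
    rw [eq_top_iff, ← Submodule.restrictScalars_top R (R ⧸ Ideal.span {x}),
      ← KaehlerDifferential.span_range_derivation k (R ⧸ Ideal.span {x}),
      Submodule.restrictScalars_span R _ Ideal.Quotient.mk_surjective, Submodule.span_le]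
    rintro _ ⟨a, rfl⟩
    obtain ⟨r, rfl⟩ := Ideal.Quotient.mk_surjective a
    exact ⟨univDerivation hΦ r, hℓ r⟩
  exact Module.length_le_of_surjective ((Submodule.liftQ _ ℓ hx).restrictScalars k)
    (LinearMap.range_eq_top (f := Submodule.liftQ _ ℓ hx).1
      ((Submodule.range_liftQ _ ℓ hx).trans hℓ_surj))

end UnivFiniteDifferentials

section Gorenstein

open CategoryTheory CategoryTheory.Abelian

universe v

variable {R : Type v} [CommRing R] {M N : Type v} [AddCommGroup M] [Module R M] [AddCommGroup N]
  [Module R N]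

/-- The complex `N → M → M ⧸ range f` of a linear map `f`, which is short exact as soon as `f` is
injective; it feeds long exact sequences of `Ext` groups. -/
abbrev cokernelShortComplex (f : N →ₗ[R] M) : ShortComplex (ModuleCat.{v} R) :=
  ModuleCat.shortComplexOfCompEqZero f f.range.mkQ f.exact_map_mkQ_range.linearMap_comp_eq_zero

theorem cokernelShortComplex_shortExact {f : N →ₗ[R] M} (hf : Function.Injective f) :
    (cokernelShortComplex f).ShortExact :=
  ModuleCat.shortComplex_shortExact _ f.exact_map_mkQ_range hf (Submodule.mkQ_surjective _)

theorem ext_quotSMulTop_eq_zero {x : R} (hx : x ∈ nonZeroDivisors R) {Y : ModuleCat.{v} R} {i : ℕ}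
    (e : Ext (ModuleCat.of R (QuotSMulTop x R)) Y (i + 2)) : e = 0 := by
  have hreg : IsSMulRegular (ModuleCat.of R R) x := (isRegular_iff_mem_nonZeroDivisors.2 hx).left
  obtain ⟨e', rfl⟩ := Ext.contravariant_sequence_exact₃ hreg.smulShortComplex_shortExact Y e
    (Ext.eq_zero_of_projective (P := ModuleCat.of R R) _) (n₀ := i + 1) (by omega)
  obtain rfl : e' = 0 := Ext.eq_zero_of_projective (P := ModuleCat.of R R) e'
  exact Ext.comp_zero (Y := ModuleCat.of R R) _ _ _ _ _

theorem nonempty_linearEquiv_of_isSimpleModule [IsLocalRing R] [IsSimpleModule R M]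
    [IsSimpleModule R N] : Nonempty (M ≃ₗ[R] N) := by
  obtain ⟨I, hI, ⟨e⟩⟩ := isSimpleModule_iff_quot_maximal.1 ‹IsSimpleModule R M›
  obtain ⟨J, hJ, ⟨f⟩⟩ := isSimpleModule_iff_quot_maximal.1 ‹IsSimpleModule R N›
  obtain rfl : I = J := (IsLocalRing.eq_maximalIdeal hI).trans (IsLocalRing.eq_maximalIdeal hJ).symm
  exact ⟨e.trans f.symm⟩

theorem exists_injective_of_isSimpleModule [IsLocalRing R] [IsSimpleModule R N] [IsArtinian R M]
    [Nontrivial M] : ∃ f : N →ₗ[R] M, Function.Injective f := by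
  obtain ⟨S, hS⟩ := IsAtomic.exists_atom (Submodule R M)
  have : IsSimpleModule R S := isSimpleModule_iff_isAtom.2 hS
  obtain ⟨e⟩ := nonempty_linearEquiv_of_isSimpleModule (R := R) (M := N) (N := S)
  exact ⟨S.subtype ∘ₗ e.toLinearMap, S.injective_subtype.comp e.injective⟩

theorem ext_eq_zero_of_isSimpleModule [IsLocalRing R] [IsSimpleModule R N] [Nontrivial M]
    (hM : IsFiniteLength R M) {Y : ModuleCat.{v} R} {i : ℕ}
    (hMY : ∀ e : Ext (ModuleCat.of R M) Y i, e = 0)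
    (hY : ∀ (L : Type v) [AddCommGroup L] [Module R L], IsFiniteLength R L →
      ∀ e : Ext (ModuleCat.of R L) Y (i + 1), e = 0)
    (e : Ext (ModuleCat.of R N) Y i) : e = 0 := by
  obtain ⟨_, _⟩ := isFiniteLength_iff_isNoetherian_isArtinian.1 hM
  obtain ⟨f, hf⟩ := exists_injective_of_isSimpleModule (R := R) (N := N) (M := M)
  have hcoker : IsFiniteLength R (M ⧸ f.range) :=
    isFiniteLength_iff_isNoetherian_isArtinian.2 ⟨inferInstance, inferInstance⟩
  obtain ⟨e', rfl⟩ := Ext.contravariant_sequence_exact₁ (cokernelShortComplex_shortExact hf) Y e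
    (add_comm 1 i) (hY _ hcoker _)
  rw [hMY e', Ext.comp_zero]

theorem ext_eq_zero_of_isFiniteLength_of_forall_isSimpleModule {Y : ModuleCat.{v} R} {i : ℕ}
    (hY : ∀ (L : Type v) [AddCommGroup L] [Module R L] [IsSimpleModule R L],
      ∀ e : Ext (ModuleCat.of R L) Y i, e = 0)
    (hM : IsFiniteLength R M) (e : Ext (ModuleCat.of R M) Y i) : e = 0 := by
  induction hM with
  | @of_subsingleton M =>
    have : 𝟙 (ModuleCat.of R M) = 0 := by ext a; exact Subsingleton.elim _ _
    rw [← Ext.mk₀_id_comp e, this, Ext.mk₀_zero, Ext.zero_comp]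
  | @of_simple_quotient M _ _ L _ _ ih =>
    obtain ⟨e', rfl⟩ := Ext.contravariant_sequence_exact₂
      (cokernelShortComplex_shortExact L.injective_subtype) Y e (ih _)
    have : IsSimpleModule R (M ⧸ L.subtype.range) := by rwa [Submodule.range_subtype]
    rw [hY _ e', Ext.comp_zero]

theorem nontrivial_quotient_span_singleton [IsLocalRing R] {x : R}
    (hx : x ∈ IsLocalRing.maximalIdeal R) : Nontrivial (R ⧸ Ideal.span {x}) :=
  Ideal.Quotient.nontrivial_iff.2 fun h => Ideal.IsPrime.ne_top inferInstance
    (top_le_iff.1 (h ▸ (Ideal.span_singleton_le_iff_mem _).2 hx))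

/-- Descending induction on `i` from the injective dimension: a simple module embeds into the
module `R ⧸ x R` of projective dimension `1`. -/
theorem ext_eq_zero_of_isGorensteinLocal [IsLocalRing R] [IsNoetherianRing R] [Ring.KrullDimLE 1 R]
    (hR : IsGorensteinLocal R) {x : R} (hx : x ∈ nonZeroDivisors R)
    (hxm : x ∈ IsLocalRing.maximalIdeal R) (hM : IsFiniteLength R M) {i : ℕ}
    (e : Ext (ModuleCat.of R M) (ModuleCat.of R R) (i + 2)) : e = 0 := by
  obtain ⟨d, hd⟩ := (injectiveDimension_ne_top_iff _).1 hR.ne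
  obtain ⟨j, hj⟩ : ∃ j, d ≤ i + j := ⟨d, by omega⟩
  induction j generalizing i M with
  | zero => exact e.eq_zero_of_hasInjectiveDimensionLT (d + 1) (by omega)
  | succ j ih =>
    have E : (R ⧸ Ideal.span {x}) ≃ₗ[R] QuotSMulTop x R :=
      ((QuotSMulTop.equivQuotTensor x R).trans (TensorProduct.rid R _)).symm
    have := nontrivial_quotient_span_singleton hxm
    have : Nontrivial (QuotSMulTop x R) := E.symm.nontrivial
    have hfin := E.isFiniteLength (isFiniteLength_quotient_span_singleton R hx)
    exact ext_eq_zero_of_isFiniteLength_of_forall_isSimpleModule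
      (fun L => ext_eq_zero_of_isSimpleModule hfin (ext_quotSMulTop_eq_zero hx)
        fun L' _ _ hL' e' => ih hL' (i := i + 1) e' (by omega)) hM e

theorem postcomp_extClass_bijective {x : R} {Y : ModuleCat.{v} R} (hx : IsSMulRegular Y x)
    {M : ModuleCat.{v} R} (hM : x ∈ Module.annihilator R M) :
    Function.Bijective
      (hx.smulShortComplex_shortExact.extClass.postcomp M (zero_add 1)) := by
  constructor
  · refine (injective_iff_map_eq_zero _).2 fun α hα => ?_
    obtain ⟨γ, rfl⟩ := Ext.covariant_sequence_exact₃ _ _ α (zero_add 1) hα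
    have : Subsingleton (M →ₗ[R] Y) := hx.linearMap_subsingleton_of_mem_annihilator hM
    have : Subsingleton (Ext M Y 0) :=
      (Ext.addEquiv₀.trans ModuleCat.homAddEquiv).subsingleton
    obtain rfl : γ = 0 := Subsingleton.elim (α := Ext M Y 0) _ _
    exact Ext.zero_comp M _ _ _ _
  · intro η
    have hη : η.comp (Ext.mk₀ (Y.smulShortComplex x).f) (add_zero 1) = 0 := by
      rw [ModuleCat.smulShortComplex_f_eq_smul_id]
      exact DFunLike.congr_fun (congrArg AddCommGrpCat.Hom.hom
        (Ext.postcomp_smul_id_eq_zero_of_mem_annihilator hM 1)) η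
    exact Ext.covariant_sequence_exact₁ _ _ η hη (zero_add 1)

theorem exists_comp_eq_of_ext_two_eq_zero {x : R} {Y : ModuleCat.{v} R} (hx : IsSMulRegular Y x)
    {S : ShortComplex (ModuleCat.{v} R)} (hS : S.ShortExact)
    (hM : x ∈ Module.annihilator R S.X₂) (hSY : ∀ e : Ext S.X₃ Y 2, e = 0)
    (φ : S.X₁ ⟶ (Y.smulShortComplex x).X₃) : ∃ ψ : S.X₂ ⟶ (Y.smulShortComplex x).X₃,
      S.f ≫ ψ = φ := by
  have hN : x ∈ Module.annihilator R S.X₁ :=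
    S.f.hom.annihilator_le_of_injective hS.moduleCat_injective_f hM
  obtain ⟨η, hη⟩ := Ext.contravariant_sequence_exact₁ hS Y
    (hx.smulShortComplex_shortExact.extClass.postcomp _ (zero_add 1) (Ext.mk₀ φ))
    (add_comm 1 1) (hSY _)
  obtain ⟨α, rfl⟩ := (postcomp_extClass_bijective hx hM).2 η
  obtain ⟨ψ, rfl⟩ := (Ext.mk₀_bijective _ _).2 α
  refine ⟨ψ, (Ext.mk₀_bijective _ _).1 ((postcomp_extClass_bijective hx hN).1 ?_)⟩
  exact (Ext.mk₀_comp_mk₀_assoc S.f ψ hx.smulShortComplex_shortExact.extClass).symm.trans hη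

theorem exists_forall_ne_zero_dvd [IsLocalRing R] {I : Ideal R} [IsArtinian R (R ⧸ I)]
    [Nontrivial (R ⧸ I)]
    (hI : ∀ (S : Submodule R (R ⧸ I)) (φ : S →ₗ[R] R ⧸ I), ∃ ψ : (R ⧸ I) →ₗ[R] R ⧸ I,
      ψ ∘ₗ S.subtype = φ) :
    ∃ s : R ⧸ I, s ≠ 0 ∧ ∀ a ≠ 0, a ∣ s := by
  obtain ⟨S, hS⟩ := IsAtomic.exists_atom (Submodule R (R ⧸ I))
  obtain ⟨s, hs, hs0⟩ := S.exists_mem_ne_zero_of_ne_bot hS.1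
  refine ⟨s, hs0, fun a ha => ?_⟩
  obtain ⟨T, hT, hTa⟩ := (IsAtomic.eq_bot_or_exists_atom_le (Submodule.span R {a})).resolve_left
    (Submodule.span_singleton_eq_bot.not.2 ha)
  have : IsSimpleModule R S := isSimpleModule_iff_isAtom.2 hS
  have : IsSimpleModule R T := isSimpleModule_iff_isAtom.2 hT
  obtain ⟨e⟩ := nonempty_linearEquiv_of_isSimpleModule (R := R) (M := S) (N := T)
  obtain ⟨ψ, hψ⟩ := hI T (S.subtype ∘ₗ e.symm.toLinearMap)
  obtain ⟨r, hr⟩ := Submodule.mem_span_singleton.1 (hTa (e ⟨s, hs⟩).2)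
  have hψs : ψ (r • a) = s := by
    rw [hr]
    simpa using LinearMap.congr_fun hψ (e ⟨s, hs⟩)
  obtain ⟨a, rfl⟩ := Ideal.Quotient.mk_surjective a
  rw [map_smul, ← mul_one a, ← smul_eq_mul, ← Ideal.Quotient.mk_eq_mk, Submodule.Quotient.mk_smul,
    map_smul, Algebra.smul_def a] at hψs
  exact hψs ▸ dvd_smul_of_dvd r (dvd_mul_right _ _)

theorem exists_linearMap_comp_subtype_eq_of_isGorensteinLocal [IsLocalRing R] [IsNoetherianRing R]
    [Ring.KrullDimLE 1 R] (hR : IsGorensteinLocal R) {x : R} (hx : x ∈ nonZeroDivisors R)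
    (hxm : x ∈ IsLocalRing.maximalIdeal R) (S : Submodule R (R ⧸ Ideal.span {x}))
    (φ : S →ₗ[R] R ⧸ Ideal.span {x}) : ∃ ψ : (R ⧸ Ideal.span {x}) →ₗ[R] R ⧸ Ideal.span {x},
      ψ ∘ₗ S.subtype = φ := by
  have hreg : IsSMulRegular (ModuleCat.of R R) x := (isRegular_iff_mem_nonZeroDivisors.2 hx).left
  let E : (R ⧸ Ideal.span {x}) ≃ₗ[R] QuotSMulTop x R :=
    ((QuotSMulTop.equivQuotTensor x R).trans (TensorProduct.rid R _)).symm
  have hfin : IsFiniteLength R ((R ⧸ Ideal.span {x}) ⧸ S.subtype.range) := by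
    obtain ⟨_, _⟩ := isFiniteLength_iff_isNoetherian_isArtinian.1
      (isFiniteLength_quotient_span_singleton R hx)
    exact isFiniteLength_iff_isNoetherian_isArtinian.2 ⟨inferInstance, inferInstance⟩
  obtain ⟨ψ, hψ⟩ := exists_comp_eq_of_ext_two_eq_zero hreg
    (cokernelShortComplex_shortExact S.injective_subtype)
    (by simp [Ideal.annihilator_quotient])
    (ext_eq_zero_of_isGorensteinLocal hR hx hxm hfin (i := 0))
    (ModuleCat.ofHom (E.toLinearMap ∘ₗ φ))
  refine ⟨E.symm.toLinearMap ∘ₗ ψ.hom, LinearMap.ext fun s => E.injective ?_⟩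
  exact (E.apply_symm_apply _).trans (LinearMap.congr_fun (congrArg ModuleCat.Hom.hom hψ) s)

theorem exists_dual_forall_mul_eq_zero_imp [IsLocalRing R] [IsNoetherianRing R]
    [Ring.KrullDimLE 1 R] (hR : IsGorensteinLocal R) {x : R} (hx : x ∈ nonZeroDivisors R)
    (hxm : x ∈ IsLocalRing.maximalIdeal R) (k : Type*) [Field k] [Algebra k R] :
    ∃ σ : Module.Dual k (R ⧸ Ideal.span {x}), ∀ a, (∀ b, σ (a * b) = 0) → a = 0 := by
  have : Nontrivial (R ⧸ Ideal.span {x}) := nontrivial_quotient_span_singleton hxm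
  obtain ⟨_, _⟩ := isFiniteLength_iff_isNoetherian_isArtinian.1
    (isFiniteLength_quotient_span_singleton R hx)
  obtain ⟨s, hs0, hs⟩ := exists_forall_ne_zero_dvd
    (exists_linearMap_comp_subtype_eq_of_isGorensteinLocal hR hx hxm)
  obtain ⟨σ, hσ⟩ := Module.Projective.exists_dual_ne_zero k hs0
  refine ⟨σ, fun a ha => by_contra fun ha0 => hσ ?_⟩
  obtain ⟨b, rfl⟩ := hs a ha0
  exact ha b

end Gorenstein

section Polynomial

open MvPolynomial

variable {σ k : Type*}

theorem coeff_sum_X_mul_pderiv [Fintype σ] [CommSemiring k] (p : MvPolynomial σ k) (d : σ →₀ ℕ) :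
    coeff d (∑ i, X i * pderiv i p) = d.degree * coeff d p := by
  classical
  rw [coeff_sum, Finsupp.degree_eq_sum, Nat.cast_sum, Finset.sum_mul]
  refine Finset.sum_congr rfl fun i _ => ?_
  rw [coeff_X_mul', coeff_pderiv]
  split_ifs with hi
  · have hle : Finsupp.single i 1 ≤ d := by
      rwa [Finsupp.single_le_iff, Nat.one_le_iff_ne_zero, ← Finsupp.mem_support_iff]
    rw [tsub_add_cancel_of_le hle, mul_comm, Finsupp.coe_tsub, Pi.sub_apply,
      Finsupp.single_eq_same, ← Nat.cast_add_one, Nat.sub_add_cancel (Finsupp.single_le_iff.1 hle)]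
  · rw [Finsupp.notMem_support_iff.1 hi, Nat.cast_zero, zero_mul]

theorem sub_C_coeff_zero_mem_pow_of_pderiv_mem [CommRing k] [NoZeroDivisors k] [CharZero k] {q : ℕ}
    {p : MvPolynomial σ k}
    (hp : ∀ i, pderiv i p ∈ idealOfVars σ k ^ q) :
    p - C (coeff 0 p) ∈ idealOfVars σ k ^ (q + 1) := by
  classical
  refine (mem_pow_idealOfVars_iff' _ _).2 fun d hd => ?_
  rw [coeff_sub, coeff_C]
  split_ifs with h0
  · rw [h0, sub_self]
  · obtain ⟨i, hi⟩ := Finsupp.ne_iff.1 (Ne.symm h0)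
    have hle : Finsupp.single i 1 ≤ d := Finsupp.single_le_iff.2 (Nat.one_le_iff_ne_zero.2 hi)
    obtain ⟨e, rfl⟩ := exists_add_of_le hle
    have he := (mem_pow_idealOfVars_iff' _ _).1 (hp i) e (by simpa [add_comm 1] using hd)
    rw [coeff_pderiv, add_comm] at he
    rw [sub_zero]
    exact (mul_eq_zero.1 he).resolve_right (Nat.cast_add_one_ne_zero _)

theorem mem_sup_pow_of_sum_X_mul_pderiv_mem [Fintype σ] [Field k] [CharZero k] {q : ℕ}
    (hq : q ≠ 0) {J : Ideal (MvPolynomial σ k)} {p : MvPolynomial σ k}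
    (hp : p ∈ idealOfVars σ k ^ q) (hJ : ∑ i, X i * pderiv i p ∈ J) :
    p ∈ J ⊔ idealOfVars σ k ^ (q + 1) := by
  have heuler : ∑ i, X i * pderiv i p - C (q : k) * p ∈ idealOfVars σ k ^ (q + 1) := by
    refine (mem_pow_idealOfVars_iff' _ _).2 fun d hd => ?_
    rw [coeff_sub, coeff_C_mul, coeff_sum_X_mul_pderiv, ← sub_mul]
    rcases (Nat.lt_succ_iff.1 hd).lt_or_eq with hlt | rfl
    · rw [(mem_pow_idealOfVars_iff' _ _).1 hp d hlt, mul_zero]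
    · rw [sub_self, zero_mul]
  have hmul : C (q : k) * p ∈ J ⊔ idealOfVars σ k ^ (q + 1) := by
    rw [← sub_sub_cancel (∑ i, X i * pderiv i p) (C (q : k) * p)]
    exact sub_mem (Ideal.mem_sup_left hJ) (Ideal.mem_sup_right heuler)
  have hunit : IsUnit (C (q : k) : MvPolynomial σ k) :=
    (isUnit_iff_ne_zero.2 (Nat.cast_ne_zero.2 hq)).map C
  exact (Ideal.unit_mul_mem_iff_mem _ hunit).1 hmul

end Polynomial

section Presentation

open MvPolynomial KaehlerDifferential

variable {σ k A : Type*}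

theorem exists_mem_ker_forall_pderiv_sub_mem_ker [CommRing k] [CommRing A] [Algebra k A]
    {φ : MvPolynomial σ k →ₐ[k] A} (hφ : Function.Surjective φ) {p : MvPolynomial σ k}
    (hp : D k A (φ p) = 0) :
    ∃ g ∈ RingHom.ker φ, ∀ i, pderiv i (p - g) ∈ RingHom.ker φ := by
  let := (φ : MvPolynomial σ k →+* A).toAlgebra
  have : IsScalarTower k (MvPolynomial σ k) A := .of_algebraMap_eq' φ.comp_algebraMap.symm
  obtain ⟨g, hg⟩ := (exact_kerCotangentToTensor_mapBaseChange k (MvPolynomial σ k) A hφ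
    (1 ⊗ₜ D k _ p)).1 (by
      rw [mapBaseChange_tmul, map_D, one_smul]
      exact hp)
  obtain ⟨g, rfl⟩ := Ideal.toCotangent_surjective _ g
  rw [kerCotangentToTensor_toCotangent] at hg
  refine ⟨g, g.2, fun i => ?_⟩
  let θ := (((Algebra.linearMap (MvPolynomial σ k) A).compDer
    (pderiv i)).liftKaehlerDifferential).liftBaseChange A
  have hθ := congrArg θ hg
  simp only [θ, LinearMap.liftBaseChange_tmul, Derivation.liftKaehlerDifferential_comp_D,
    one_smul] at hθ
  rw [RingHom.mem_ker, map_sub, map_sub, sub_eq_zero]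
  exact hθ.symm

variable [Finite σ] [Field k] [CharZero k] [CommRing A] [Algebra k A]

/-- Modulo `ker φ`, a polynomial whose differential vanishes in `Ω[A⁄k]` has all its derivatives
in `ker φ`; Euler's formula then gains one order over what `ker φ ≤ 𝔪²` gives. -/
theorem exists_sub_algebraMap_mem_map_pow_four {φ : MvPolynomial σ k →ₐ[k] A}
    (hφ : Function.Surjective φ) (hker : RingHom.ker φ ≤ idealOfVars σ k ^ 2) {a : A}
    (ha : D k A a = 0) :
    ∃ c : k, a - algebraMap k A c ∈ (idealOfVars σ k).map φ ^ 4 := by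
  have := Fintype.ofFinite σ
  obtain ⟨p, rfl⟩ := hφ a
  obtain ⟨g, hg, hpg⟩ := exists_mem_ker_forall_pderiv_sub_mem_ker hφ ha
  let c := coeff 0 (p - g)
  have hcube : p - g - C c ∈ idealOfVars σ k ^ 3 :=
    sub_C_coeff_zero_mem_pow_of_pderiv_mem fun i => hker (hpg i)
  have hfour := mem_sup_pow_of_sum_X_mul_pderiv_mem three_ne_zero hcube
    (J := RingHom.ker φ) (sum_mem fun i _ => Ideal.mul_mem_left _ _ (by simpa using hpg i))
  have hmem : φ (p - g - C c) ∈ (RingHom.ker φ ⊔ idealOfVars σ k ^ 4).map φ :=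
    Ideal.mem_map_of_mem φ hfour
  rw [Ideal.map_sup, (Ideal.map_eq_bot_iff_le_ker φ).2 le_rfl, bot_sup_eq, Ideal.map_pow] at hmem
  refine ⟨c, ?_⟩
  simpa [RingHom.mem_ker.1 hg, ← algebraMap_eq] using hmem

end Presentation

section Augmentation

open MvPolynomial

theorem sup_pow_smul_top_eq_top {P M : Type*} [CommRing P] [AddCommGroup M] [Module P M]
    {I : Ideal P} {N : Submodule P M} (hN : N ⊔ I • ⊤ = ⊤) (j : ℕ) : N ⊔ I ^ j • ⊤ = ⊤ := by
  induction j with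
  | zero => simp
  | succ j ih =>
    have hle : I ^ j • (⊤ : Submodule P M) ≤ N ⊔ I ^ (j + 1) • ⊤ := by
      conv_lhs => rw [← hN]
      rw [Submodule.smul_sup, ← Submodule.mul_smul, ← pow_succ]
      exact sup_le_sup_right Submodule.smul_le_right _
    exact eq_top_iff.2 (ih.ge.trans (sup_le le_sup_left hle))

variable {k A : Type*} [CommRing k] [CommRing A] [Algebra k A] (ε : A →ₐ[k] k)

theorem sub_algebraMap_mem_ker (a : A) : a - algebraMap k A (ε a) ∈ RingHom.ker ε := by
  rw [RingHom.mem_ker, map_sub, ε.commutes, Algebra.algebraMap_self_apply, sub_self]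

theorem smul_cotangent_ker_eq (a : A) (v : (RingHom.ker ε).Cotangent) : a • v = ε a • v := by
  rw [← sub_eq_zero, ← algebraMap_smul A (ε a) v, ← sub_smul]
  exact Ideal.Cotangent.smul_eq_zero_of_mem (sub_algebraMap_mem_ker ε a) v

/-- The universal derivation at the `k`-point `ε` of `A`: it sends `a` to the class of `a - ε a` in
the cotangent space of `ε`. -/
noncomputable def pointDerivation : Derivation k A (RingHom.ker ε).Cotangent :=
  .mk' ((((RingHom.ker ε).toCotangent).restrictScalars k).comp
      ((LinearMap.id - (Algebra.linearMap k A).comp ε.toLinearMap).codRestrict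
        ((RingHom.ker ε).restrictScalars k) (sub_algebraMap_mem_ker ε)))
    fun a b => by
      refine (Ideal.toCotangent_eq _).2 ?_
      change a * b - algebraMap k A (ε (a * b)) - (a * (b - algebraMap k A (ε b)) +
        b * (a - algebraMap k A (ε a))) ∈ RingHom.ker ε ^ 2
      convert neg_mem (Ideal.mul_mem_mul (sub_algebraMap_mem_ker ε a) (sub_algebraMap_mem_ker ε b))
        using 1
      · rw [sq]
      · rw [map_mul, map_mul]
        ring

theorem pointDerivation_apply_of_mem {a : A} (ha : a ∈ RingHom.ker ε) :
    pointDerivation ε a = (RingHom.ker ε).toCotangent ⟨a, ha⟩ := by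
  refine congrArg (RingHom.ker ε).toCotangent (Subtype.ext ?_)
  change a - algebraMap k A (ε a) = a
  rw [RingHom.mem_ker.1 ha, map_zero, sub_zero]

theorem pointDerivation_surjective : Function.Surjective (pointDerivation ε) := fun v => by
  obtain ⟨a, rfl⟩ := Ideal.toCotangent_surjective _ v
  exact ⟨a, pointDerivation_apply_of_mem ε a.2⟩

variable {σ : Type*} {y : σ → A}

theorem aeval_surjective_of_span_range_eq_ker (hy : Ideal.span (Set.range y) = RingHom.ker ε)
    (hε : IsNilpotent (RingHom.ker ε)) :
    Function.Surjective (aeval y : MvPolynomial σ k →ₐ[k] A) := by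
  obtain ⟨j, hj⟩ := hε
  let := (aeval y : MvPolynomial σ k →ₐ[k] A).toAlgebra
  have hmap : (idealOfVars σ k).map (algebraMap (MvPolynomial σ k) A) = RingHom.ker ε := by
    rw [← hy, idealOfVars, Ideal.map_span, ← Set.range_comp]
    exact congrArg (fun z => Ideal.span (Set.range z)) (funext (aeval_X y))
  have hsup : LinearMap.range (Algebra.linearMap (MvPolynomial σ k) A) ⊔
      idealOfVars σ k • ⊤ = ⊤ := by
    rw [Ideal.smul_top_eq_map, hmap, eq_top_iff]
    intro a _
    rw [← add_sub_cancel (algebraMap k A (ε a)) a]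
    exact Submodule.add_mem_sup ⟨C (ε a), aeval_C y _⟩ (sub_algebraMap_mem_ker ε a)
  have htop := sup_pow_smul_top_eq_top hsup j
  rw [Ideal.smul_top_eq_map, Ideal.map_pow, hmap, hj] at htop
  exact LinearMap.range_eq_top.1 (by simpa using htop)

theorem apply_aeval_eq_constantCoeff (hy : ∀ i, y i ∈ RingHom.ker ε) (p : MvPolynomial σ k) :
    ε (aeval y p) = constantCoeff p := by
  rw [← AlgHom.comp_apply, comp_aeval, funext fun i => RingHom.mem_ker.1 (hy i)]
  exact aeval_zero p

theorem pointDerivation_aeval [Fintype σ] (hy : ∀ i, y i ∈ RingHom.ker ε) (p : MvPolynomial σ k) :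
    pointDerivation ε (aeval y p) =
      ∑ i, coeff (Finsupp.single i 1) p • pointDerivation ε (y i) := by
  classical
  induction p using MvPolynomial.induction_on with
  | C a => simp [coeff_C, eq_comm (a := (0 : σ →₀ ℕ))]
  | add p q hp hq => simp only [map_add, hp, hq, coeff_add, add_smul, Finset.sum_add_distrib]
  | mul_X p j _ =>
    have hcoeff (i : σ) : coeff (Finsupp.single i 1) (p * X j) =
        if i = j then constantCoeff p else 0 := by
      rw [coeff_mul_X']
      rcases eq_or_ne i j with rfl | hij
      · simp [constantCoeff_eq]
      · simp [hij, hij.symm]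
    simp [smul_cotangent_ker_eq, apply_aeval_eq_constantCoeff ε hy, RingHom.mem_ker.1 (hy j),
      hcoeff]

theorem ker_aeval_le_idealOfVars_sq [Finite σ] (hy : ∀ i, y i ∈ RingHom.ker ε)
    (hli : LinearIndependent k fun i => pointDerivation ε (y i)) :
    RingHom.ker (aeval y : MvPolynomial σ k →ₐ[k] A) ≤ idealOfVars σ k ^ 2 := fun p hp => by
  have := Fintype.ofFinite σ
  refine (mem_pow_idealOfVars_iff' _ _).2 fun d hd => ?_
  rw [RingHom.mem_ker] at hp
  rcases Nat.lt_succ_iff_lt_or_eq.1 hd with h0 | h1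
  · rw [(Finsupp.degree_eq_zero_iff d).1 (Nat.lt_one_iff.1 h0), ← constantCoeff_eq,
      ← apply_aeval_eq_constantCoeff ε hy, hp, map_zero]
  · obtain ⟨i, rfl⟩ := (Finsupp.sum_eq_one_iff d).1 h1
    refine Fintype.linearIndependent_iff.1 hli (fun i => coeff (Finsupp.single i 1) p) ?_ i
    rw [← pointDerivation_aeval ε hy, hp, map_zero]

theorem span_range_eq_ker_of_span_pointDerivation (hε : IsNilpotent (RingHom.ker ε))
    (hy : ∀ i, y i ∈ RingHom.ker ε)
    (hspan : Submodule.span k (Set.range fun i => pointDerivation ε (y i)) = ⊤) :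
    Ideal.span (Set.range y) = RingHom.ker ε := by
  obtain ⟨j, hj⟩ := hε
  let N : Submodule A (RingHom.ker ε) := Submodule.span A (Set.range fun i => ⟨y i, hy i⟩)
  have hmap : N.map (RingHom.ker ε).subtype = Ideal.span (Set.range y) := by
    rw [Submodule.map_span, ← Set.range_comp]
    rfl
  have hsup : N ⊔ RingHom.ker ε • ⊤ = ⊤ := by
    have hδ : N.map (RingHom.ker ε).toCotangent =
        Submodule.span A (Set.range fun i => pointDerivation ε (y i)) := by
      rw [Submodule.map_span, ← Set.range_comp]
      exact congrArg _ (congrArg _ (funext fun i => (pointDerivation_apply_of_mem ε (hy i)).symm))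
    rw [sup_comm, ← Submodule.map_mkQ_eq_top]
    refine hδ.trans (eq_top_iff.2 fun v _ => ?_)
    exact Submodule.span_le_restrictScalars k A _ (hspan ▸ Submodule.mem_top)
  have htop := sup_pow_smul_top_eq_top hsup j
  rw [hj, Ideal.zero_eq_bot, Submodule.bot_smul, sup_bot_eq] at htop
  rw [← hmap, htop, Submodule.map_top, Submodule.range_subtype]

end Augmentation

section CotangentSpace

open MvPolynomial

variable {k A : Type*} [Field k] [CommRing A] [Algebra k A] (ε : A →ₐ[k] k)
  [Module.Finite k (RingHom.ker ε).Cotangent]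

theorem exists_linearIndependent_pointDerivation_span_range_eq_ker
    (hε : IsNilpotent (RingHom.ker ε)) :
    ∃ y : Fin (Module.finrank k (RingHom.ker ε).Cotangent) → A,
      LinearIndependent k (fun i => pointDerivation ε (y i)) ∧
        Ideal.span (Set.range y) = RingHom.ker ε := by
  let b := Module.finBasis k (RingHom.ker ε).Cotangent
  choose y hy using fun i => Ideal.toCotangent_surjective _ (b i)
  have hyb : (fun i => pointDerivation ε (y i)) = b :=
    funext fun i => (pointDerivation_apply_of_mem ε (y i).2).trans (hy i)
  exact ⟨fun i => y i, hyb ▸ b.linearIndependent,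
    span_range_eq_ker_of_span_pointDerivation ε hε (fun i => (y i).2) (hyb ▸ b.span_eq)⟩

theorem spanFinrank_ker_le_finrank_cotangent (hε : IsNilpotent (RingHom.ker ε)) :
    (RingHom.ker ε).spanFinrank ≤ Module.finrank k (RingHom.ker ε).Cotangent := by
  obtain ⟨y, -, hspan⟩ := exists_linearIndependent_pointDerivation_span_range_eq_ker ε hε
  calc (RingHom.ker ε).spanFinrank = (Ideal.span (Set.range y)).spanFinrank := by rw [hspan]
    _ ≤ (Set.range y).ncard := Submodule.spanFinrank_span_le_ncard_of_finite (Set.finite_range y)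
    _ ≤ Nat.card (Fin _) := by
      rw [← Set.image_univ, ← Set.ncard_univ]
      exact Set.ncard_image_le
    _ = Module.finrank k (RingHom.ker ε).Cotangent := Nat.card_fin _

theorem exists_sub_algebraMap_mem_ker_pow_four [CharZero k] (hε : IsNilpotent (RingHom.ker ε))
    {a : A} (ha : KaehlerDifferential.D k A a = 0) :
    ∃ c : k, a - algebraMap k A c ∈ RingHom.ker ε ^ 4 := by
  obtain ⟨y, hli, hspan⟩ := exists_linearIndependent_pointDerivation_span_range_eq_ker ε hε
  have hy (i) : y i ∈ RingHom.ker ε := hspan ▸ Ideal.subset_span ⟨i, rfl⟩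
  obtain ⟨c, hc⟩ := exists_sub_algebraMap_mem_map_pow_four
    (aeval_surjective_of_span_range_eq_ker ε hspan hε) (ker_aeval_le_idealOfVars_sq ε hy hli) ha
  rw [idealOfVars, Ideal.map_span, ← Set.range_comp] at hc
  refine ⟨c, ?_⟩
  rw [← hspan]
  simpa [Function.comp_def] using hc

end CotangentSpace

section Exterior

theorem exists_linearMap_kaehlerDifferential_of_leibniz {k A W : Type*} [CommRing k] [CommRing A]
    [Algebra k A] [AddCommGroup W] [Module k W] (B : A →ₗ[k] A →ₗ[k] W)
    (hB : ∀ a b c, B a (b * c) = B (a * b) c + B (a * c) b) :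
    ∃ β : Ω[A⁄k] →ₗ[k] W, ∀ a b, β (a • KaehlerDifferential.D k A b) = B a b := by
  -- `b ↦ B · b` is a derivation into `Hom k A W`, on which `A` acts through its action on `A`.
  let : Module A (A →ₗ[k] W) :=
    { smul a f := f ∘ₗ LinearMap.mulLeft k a
      one_smul f := by ext c; exact congrArg f (one_mul c)
      mul_smul a b f := by
        ext c; exact congrArg f (by simp [mul_left_comm])
      smul_zero a := by ext c; rfl
      smul_add a f g := by ext c; rfl
      add_smul a b f := by ext c; exact (congrArg f (add_mul a b c)).trans (map_add f _ _)
      zero_smul f := by ext c; exact (congrArg f (zero_mul c)).trans (map_zero f) }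
  have hsmul (a : A) (f : A →ₗ[k] W) (c : A) : (a • f) c = f (a * c) := rfl
  have : IsScalarTower k A (A →ₗ[k] W) := ⟨fun r a f => by ext c; simp [hsmul]⟩
  let d : Derivation k A (A →ₗ[k] W) := .mk' B.flip fun b c => by
    ext a
    simp only [LinearMap.flip_apply, LinearMap.add_apply, hsmul, hB, mul_comm]
  let ev : (A →ₗ[k] W) →ₗ[k] W := LinearMap.applyₗ 1
  refine ⟨ev ∘ₗ d.liftKaehlerDifferential.restrictScalars k, fun a b => ?_⟩
  have : d.liftKaehlerDifferential (a • KaehlerDifferential.D k A b) = a • d b := by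
    rw [map_smul, d.liftKaehlerDifferential_comp_D]
  simp [ev, this, hsmul, d]

theorem exists_linearMap_kaehlerDifferential_exteriorPower {k A : Type*} [CommRing k] [CommRing A]
    [Algebra k A] (ε : A →ₐ[k] k) :
    ∃ β : Ω[A⁄k] →ₗ[k] ⋀[k]^2 (RingHom.ker ε).Cotangent, ∀ a b,
      β (a • KaehlerDifferential.D k A b) =
        exteriorPower.ιMulti k 2 ![pointDerivation ε a, pointDerivation ε b] := by
  let f := exteriorPower.ιMulti k 2 (M := (RingHom.ker ε).Cotangent)
  let wedge := LinearMap.mk₂ k (fun v w => f ![v, w]) (fun v v' w => f.map_vecCons_add ![w] v v')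
    (fun c v w => f.map_vecCons_smul ![w] c v) (fun v => (f.curryLeft v).map_vecCons_add ![])
    (fun c v => (f.curryLeft v).map_vecCons_smul ![] c)
  have hself (v) : wedge v v = 0 := f.map_eq_zero_of_eq _ (i := 0) (j := 1) rfl (by decide)
  have hswap (v w) : wedge v w = - wedge w v := by
    have := hself (v + w)
    simp only [map_add, LinearMap.add_apply, hself, zero_add, add_zero] at this
    exact eq_neg_of_add_eq_zero_right this
  refine exists_linearMap_kaehlerDifferential_of_leibniz
    (wedge.compl₁₂ (pointDerivation ε).toLinearMap (pointDerivation ε).toLinearMap)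
    fun a b c => ?_
  simp only [LinearMap.compl₁₂_apply, Derivation.coeFn_coe,
    Derivation.leibniz, smul_cotangent_ker_eq, map_add, map_smul, LinearMap.add_apply,
    LinearMap.smul_apply, hswap (pointDerivation ε c) (pointDerivation ε b)]
  module

end Exterior

section Frobenius

variable {k A : Type*} [Field k] [CommRing A] [Algebra k A]

theorem finrank_add_finrank_le_of_mul_eq_bot [Module.Finite k A] {I J : Ideal A} (hIJ : I * J = ⊥)
    (σ : Module.Dual k A) (hσ : ∀ a, (∀ b, σ (a * b) = 0) → a = 0) :
    Module.finrank k I + Module.finrank k J ≤ Module.finrank k A := by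
  let pairing : A →ₗ[k] Module.Dual k A := (LinearMap.mul k A).compr₂ σ
  have hinj : Function.Injective pairing := (injective_iff_map_eq_zero _).2 fun a ha =>
    hσ a fun b => LinearMap.congr_fun ha b
  have hle : (I.restrictScalars k).map pairing ≤ (J.restrictScalars k).dualAnnihilator := by
    rintro _ ⟨a, ha, rfl⟩
    refine (Submodule.mem_dualAnnihilator _).2 fun b hb => ?_
    have hab : a * b = 0 := (hIJ ▸ Ideal.mul_mem_mul ha hb : a * b ∈ (⊥ : Ideal A))
    exact (congrArg σ hab).trans (map_zero σ)
  have hI := Submodule.finrank_mono hle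
  rw [← (Submodule.equivMapOfInjective pairing hinj _).finrank_eq] at hI
  have hJ := Subspace.finrank_add_finrank_dualAnnihilator_eq (J.restrictScalars k)
  change Module.finrank k I ≤ _ at hI
  change Module.finrank k J + _ = _ at hJ
  omega

variable (ε : A →ₐ[k] k)

theorem finite_cotangent_ker [Module.Finite k A] : Module.Finite k (RingHom.ker ε).Cotangent :=
  .of_surjective (pointDerivation ε).toLinearMap (pointDerivation_surjective ε)

theorem finrank_le_finrank_ker_sq_add [Module.Finite k A] :
    Module.finrank k A ≤ Module.finrank k ↥(RingHom.ker ε ^ 2) +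
      (1 + Module.finrank k (RingHom.ker ε).Cotangent) := by
  have := finite_cotangent_ker ε
  let jet : A →ₗ[k] k × (RingHom.ker ε).Cotangent :=
    ε.toLinearMap.prod (pointDerivation ε).toLinearMap
  have hker : LinearMap.ker jet ≤ (RingHom.ker ε ^ 2).restrictScalars k := fun a ha => by
    have hεa : a ∈ RingHom.ker ε := congrArg Prod.fst ha
    have hδa : pointDerivation ε a = 0 := congrArg Prod.snd ha
    rw [pointDerivation_apply_of_mem ε hεa] at hδa
    exact (Ideal.toCotangent_eq_zero _ _).1 hδa
  have hjet := LinearMap.finrank_range_add_finrank_ker jet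
  have hrange := Submodule.finrank_le (LinearMap.range jet)
  rw [Module.finrank_prod, Module.finrank_self] at hrange
  have hsq : Module.finrank k (LinearMap.ker jet) ≤ Module.finrank k ↥(RingHom.ker ε ^ 2) :=
    Submodule.finrank_mono hker
  omega

theorem choose_two_add_finrank_range_D_le [Module.Finite k A] :
    (Module.finrank k (RingHom.ker ε).Cotangent).choose 2 +
      Module.finrank k (LinearMap.range (KaehlerDifferential.D k A).toLinearMap) ≤
        Module.finrank k (Ω[A⁄k]) := by
  have := finite_cotangent_ker ε
  have : Module.Finite k (Ω[A⁄k]) := .trans A _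
  obtain ⟨β, hβ⟩ := exists_linearMap_kaehlerDifferential_exteriorPower ε
  have hβsurj : LinearMap.range β = ⊤ := by
    rw [eq_top_iff, ← exteriorPower.ιMulti_span, Submodule.span_le]
    rintro _ ⟨v, rfl⟩
    obtain ⟨a, ha⟩ := pointDerivation_surjective ε (v 0)
    obtain ⟨b, hb⟩ := pointDerivation_surjective ε (v 1)
    refine ⟨a • KaehlerDifferential.D k A b, ?_⟩
    rw [hβ, ha, hb]
    exact congrArg _ (List.ofFn_injective rfl)
  have hβD : LinearMap.range (KaehlerDifferential.D k A).toLinearMap ≤ LinearMap.ker β := by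
    rintro _ ⟨b, rfl⟩
    have h := hβ 1 b
    rw [one_smul, Derivation.map_one_eq_zero, AlternatingMap.map_coord_zero (i := 0) _ rfl] at h
    exact h
  have hdim := LinearMap.finrank_range_add_finrank_ker β
  rw [hβsurj, finrank_top, exteriorPower.finrank_eq] at hdim
  have := Submodule.finrank_mono hβD
  omega

theorem finrank_le_finrank_range_D_add [CharZero k] [Module.Finite k A]
    (hε : IsNilpotent (RingHom.ker ε)) :
    Module.finrank k A ≤
      Module.finrank k (LinearMap.range (KaehlerDifferential.D k A).toLinearMap) +
        (1 + Module.finrank k ↥(RingHom.ker ε ^ 4)) := by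
  have := finite_cotangent_ker ε
  have hker : LinearMap.ker (KaehlerDifferential.D k A).toLinearMap ≤
      LinearMap.range (Algebra.linearMap k A) ⊔ (RingHom.ker ε ^ 4).restrictScalars k := by
    intro a ha
    obtain ⟨c, hc⟩ := exists_sub_algebraMap_mem_ker_pow_four ε hε ha
    rw [← add_sub_cancel (algebraMap k A c) a]
    exact Submodule.add_mem_sup ⟨c, rfl⟩ hc
  have hle : Module.finrank k (LinearMap.ker (KaehlerDifferential.D k A).toLinearMap) ≤
      Module.finrank k (LinearMap.range (Algebra.linearMap k A)) +
        Module.finrank k ↥(RingHom.ker ε ^ 4) :=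
    (Submodule.finrank_mono hker).trans (Submodule.finrank_add_le_finrank_add_finrank _ _)
  have hone := LinearMap.finrank_range_le (Algebra.linearMap k A)
  rw [Module.finrank_self] at hone
  have hD := LinearMap.finrank_range_add_finrank_ker (KaehlerDifferential.D k A).toLinearMap
  omega

theorem add_three_le_choose_two {h : ℕ} (hh : 5 ≤ h) : h + 3 ≤ h.choose 2 := by
  induction h, hh using Nat.le_induction with
  | base => decide
  | succ h _ ih =>
    have hpascal : (h + 1).choose 2 = h + h.choose 2 := by
      rw [Nat.choose_succ_succ' h 1, Nat.choose_one_right]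
    omega

theorem finrank_lt_finrank_kaehlerDifferential [CharZero k] [Module.Finite k A]
    (hε : RingHom.ker ε ^ 6 = ⊥) (hV : 5 ≤ Module.finrank k (RingHom.ker ε).Cotangent)
    (σ : Module.Dual k A) (hσ : ∀ a, (∀ b, σ (a * b) = 0) → a = 0) :
    Module.finrank k A < Module.finrank k (Ω[A⁄k]) := by
  have hΩ := choose_two_add_finrank_range_D_le ε
  have hD := finrank_le_finrank_range_D_add ε ⟨6, hε⟩
  have hsq := finrank_le_finrank_ker_sq_add ε
  have hdual := finrank_add_finrank_le_of_mul_eq_bot (I := RingHom.ker ε ^ 4)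
    (J := RingHom.ker ε ^ 2) (by rw [← pow_add, hε]) σ hσ
  have hchoose := add_three_le_choose_two hV
  omega

end Frobenius

section EmbeddingDimension

theorem spanFinrank_le_spanFinrank_map_mk_add_one {R : Type*} [CommRing R] {I : Ideal R}
    (hI : I.FG) {x : R} (hx : x ∈ I) :
    I.spanFinrank ≤ (I.map (Ideal.Quotient.mk (Ideal.span {x}))).spanFinrank + 1 := by
  let π := Ideal.Quotient.mk (Ideal.span {x})
  have hπ : Submodule.FG (I.map π) := hI.map π
  let s := Function.surjInv Ideal.Quotient.mk_surjective '' (I.map π).generators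
  have hs : (Ideal.span s).map π = I.map π := by
    rw [Ideal.map_span, ← Set.image_comp, Function.RightInverse.id
      (Function.rightInverse_surjInv Ideal.Quotient.mk_surjective), Set.image_id]
    exact Submodule.span_generators _
  have hspan : Ideal.span (insert x s) = I := by
    have h := congrArg (Ideal.comap π) hs
    rwa [Ideal.comap_map_of_surjective' π Ideal.Quotient.mk_surjective,
      Ideal.comap_map_of_surjective' π Ideal.Quotient.mk_surjective, Ideal.mk_ker,
      sup_eq_left.2 ((Ideal.span_singleton_le_iff_mem I).2 hx), sup_comm, ← Ideal.span_insert] at h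
  have hfin : s.Finite := hπ.finite_generators.image _
  calc I.spanFinrank = (Ideal.span (insert x s)).spanFinrank := by rw [hspan]
    _ ≤ (insert x s).ncard := Submodule.spanFinrank_span_le_ncard_of_finite (hfin.insert x)
    _ ≤ s.ncard + 1 := Set.ncard_insert_le x s
    _ ≤ (I.map π).generators.ncard + 1 :=
      Nat.add_le_add_right (Set.ncard_image_le hπ.finite_generators) 1
    _ = (I.map π).spanFinrank + 1 := by rw [hπ.generators_ncard]

end EmbeddingDimension

section Torsion

theorem ne_zero_of_pow_le_span_singleton {R : Type*} [CommRing R] [NoZeroDivisors R] {I : Ideal R}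
    (hI : I ≠ ⊥) {x : R} {j : ℕ} (hj : I ^ j ≤ Ideal.span {x}) : x ≠ 0 := by
  rintro rfl
  rw [Ideal.span_singleton_eq_bot.2 rfl, le_bot_iff] at hj
  exact hI (eq_zero_of_pow_eq_zero hj)

variable {k R : Type*} [Field k] [CommRing R] [IsLocalRing R] [Algebra k R]

open IsLocalRing (maximalIdeal ResidueField residue)

theorem exists_sub_algebraMap_mem_maximalIdeal
    (hres : Function.Surjective (algebraMap k (ResidueField R))) (r : R) :
    ∃ c : k, r - algebraMap k R c ∈ maximalIdeal R := by
  obtain ⟨c, hc⟩ := hres (residue R r)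
  refine ⟨c, ?_⟩
  rw [← IsLocalRing.residue_eq_zero_iff, map_sub, ← hc, sub_eq_zero]
  rfl

theorem exists_surjective_mvPowerSeries_algHom [IsNoetherianRing R]
    [IsAdicComplete (maximalIdeal R) R]
    (hres : Function.Surjective (algebraMap k (ResidueField R))) {n : ℕ}
    (hn : (maximalIdeal R).spanFinrank = n) :
    ∃ Φ : MvPowerSeries (Fin n) k →ₐ[k] R, Function.Surjective Φ := by
  obtain ⟨s, hs, hspan⟩ :=
    (IsNoetherian.noetherian (maximalIdeal R)).exists_span_finset_card_eq_spanFinrank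
  let y : Fin n → R := (↑) ∘ (s.equivFinOfCardEq (hs.trans hn)).symm
  have hy : Ideal.span (Set.range y) = maximalIdeal R := by
    rw [EquivLike.range_comp, Subtype.range_coe]
    exact hspan
  obtain ⟨Φ, hΦ⟩ := exists_mvPowerSeries_algHom (k := k) (I := maximalIdeal R) (y := y)
    fun i => hy ▸ Ideal.subset_span ⟨i, rfl⟩
  refine ⟨Φ, mvPowerSeries_algHom_surjective (exists_sub_algebraMap_mem_maximalIdeal hres) ?_⟩
  simpa only [hΦ] using hy

theorem exists_algHom_quotient_ker_eq_map_maximalIdeal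
    (hres : Function.Surjective (algebraMap k (ResidueField R))) {I : Ideal R}
    (hI : I ≤ maximalIdeal R) :
    ∃ ε : (R ⧸ I) →ₐ[k] k, RingHom.ker ε = (maximalIdeal R).map (Ideal.Quotient.mk I) := by
  let e := AlgEquiv.ofBijective (Algebra.ofId k (ResidueField R))
    ⟨(algebraMap k (ResidueField R)).injective, hres⟩
  let ε₀ : R →ₐ[k] k := e.symm.toAlgHom.comp (IsScalarTower.toAlgHom k R (ResidueField R))
  have hε₀ : RingHom.ker ε₀ = maximalIdeal R := by
    ext r
    rw [RingHom.mem_ker, ← IsLocalRing.residue_eq_zero_iff]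
    exact map_eq_zero_iff e.symm e.symm.injective
  have hI₀ : I ≤ RingHom.ker ε₀ := hI.trans hε₀.ge
  exact ⟨Ideal.Quotient.liftₐ I ε₀ hI₀,
    hε₀ ▸ Ideal.ker_quotient_lift ε₀.toRingHom hI₀⟩

variable [IsDomain R] [IsNoetherianRing R] {x : R}

theorem length_quotient_lt_length_kaehlerDifferential [CharZero k]
    (hres : Function.Surjective (algebraMap k (ResidueField R))) (hR : IsGorensteinLocal R)
    (hn : 6 ≤ (maximalIdeal R).spanFinrank) (hx0 : x ≠ 0) (hx : x ∈ maximalIdeal R)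
    (hm : maximalIdeal R ^ 6 ≤ Ideal.span {x}) :
    Module.length k (R ⧸ Ideal.span {x}) < Module.length k (Ω[(R ⧸ Ideal.span {x})⁄k]) := by
  have := krullDimLE_one_of_maximalIdeal_pow_le_span_singleton hx hm
  have hxR := mem_nonZeroDivisors_of_ne_zero hx0
  have : Module.Finite k (ResidueField R) := .of_surjective (Algebra.linearMap k _) hres
  have : Module.Finite k (R ⧸ Ideal.span {x}) :=
    finite_of_isFiniteLength k (isFiniteLength_quotient_span_singleton R hxR)
  have : Module.Finite k (Ω[(R ⧸ Ideal.span {x})⁄k]) := .trans (R ⧸ Ideal.span {x}) _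
  obtain ⟨σ, hσ⟩ := exists_dual_forall_mul_eq_zero_imp hR hxR hx k
  obtain ⟨ε, hε⟩ := exists_algHom_quotient_ker_eq_map_maximalIdeal hres
    ((Ideal.span_singleton_le_iff_mem _).2 hx)
  have := finite_cotangent_ker ε
  have hε6 : RingHom.ker ε ^ 6 = ⊥ := by
    rwa [hε, ← Ideal.map_pow, Ideal.map_eq_bot_iff_le_ker, Ideal.mk_ker]
  have hV : 5 ≤ Module.finrank k (RingHom.ker ε).Cotangent := by
    have hR := spanFinrank_le_spanFinrank_map_mk_add_one (IsNoetherian.noetherian _) hx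
    have hA := spanFinrank_ker_le_finrank_cotangent ε ⟨6, hε6⟩
    rw [← hε] at hR
    omega
  rw [Module.length_eq_finrank, Module.length_eq_finrank, Nat.cast_lt]
  exact finrank_lt_finrank_kaehlerDifferential ε hε6 hV σ hσ

theorem length_kaehlerDifferential_le_of_torsion_eq_bot [CharZero k]
    [Module.Finite k (ResidueField R)] [Ring.KrullDimLE 1 R] [IsAdicComplete (maximalIdeal R) R]
    {n : ℕ} {Φ : MvPowerSeries (Fin n) k →ₐ[k] R} (hΦ : Function.Surjective Φ)
    (htors : Submodule.torsion R (UnivFiniteDifferentials Φ) = ⊥) (hx0 : x ≠ 0)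
    (hx : x ∈ maximalIdeal R) :
    Module.length k (Ω[(R ⧸ Ideal.span {x})⁄k]) ≤ Module.length k (R ⧸ Ideal.span {x}) := by
  have := Submodule.isTorsionFree_iff_torsion_eq_bot.2 htors
  have : Module.Finite k (R ⧸ Ideal.span {x}) := finite_of_isFiniteLength k
    (isFiniteLength_quotient_span_singleton R (mem_nonZeroDivisors_of_ne_zero hx0))
  exact (length_kaehlerDifferential_le_length_quotSMulTop hΦ x).trans
    (length_quotSMulTop_le_of_derivation _ (span_range_univDerivation hΦ) hx0 hx)

end Torsion

end Berger

theorem mainTheorem2_general {k : Type*} [Field k] [CharZero k]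
    {R : Type*} [CommRing R] [IsDomain R] [IsLocalRing R] [IsNoetherianRing R] [Algebra k R]
    [IsAdicComplete (IsLocalRing.maximalIdeal R) R]
    (hres : Function.Surjective (algebraMap k (IsLocalRing.ResidueField R)))
    (hGor : Berger.IsGorensteinLocal R)
    (n : ℕ) (hedim : (IsLocalRing.maximalIdeal R).spanFinrank = n) (hn : 6 ≤ n)
    (x : R) (hx : x ∈ IsLocalRing.maximalIdeal R)
    (hm : IsLocalRing.maximalIdeal R ^ 6 ≤ Ideal.span {x}) :
    (∃ Φ : MvPowerSeries (Fin n) k →ₐ[k] R, Function.Surjective Φ) ∧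
    ∀ Φ : MvPowerSeries (Fin n) k →ₐ[k] R, Function.Surjective Φ →
      Submodule.torsion R (Berger.UnivFiniteDifferentials Φ) ≠ ⊥ := by
  refine ⟨Berger.exists_surjective_mvPowerSeries_algHom hres hedim, fun Φ hΦ htors => ?_⟩
  have hR : IsLocalRing.maximalIdeal R ≠ ⊥ := fun h => by
    rw [h, Submodule.spanFinrank_bot] at hedim
    omega
  have hx0 := Berger.ne_zero_of_pow_le_span_singleton hR hm
  have := Berger.krullDimLE_one_of_maximalIdeal_pow_le_span_singleton hx hm
  have : Module.Finite k (IsLocalRing.ResidueField R) := .of_surjective (Algebra.linearMap k _) hres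
  have hlt := Berger.length_quotient_lt_length_kaehlerDifferential hres hGor
    (hedim ▸ hn) hx0 hx hm
  exact hlt.not_ge (Berger.length_kaehlerDifferential_le_of_torsion_eq_bot hΦ htors hx0 hx)

theorem mainTheorem2 {k : Type*} [Field k] [IsAlgClosed k] [CharZero k]
    {R : Type*} [CommRing R] [IsDomain R] [IsLocalRing R] [IsNoetherianRing R] [Algebra k R]
    [IsAdicComplete (IsLocalRing.maximalIdeal R) R]
    (hres : Function.Bijective (algebraMap k (IsLocalRing.ResidueField R)))
    (hdim : ringKrullDim R = 1)
    (hGor : Berger.IsGorensteinLocal R)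
    (n : ℕ) (hedim : (IsLocalRing.maximalIdeal R).spanFinrank = n) (hn : 6 ≤ n)
    (x : R) (hx : Berger.IsMinimalReduction (Ideal.span {x}) (IsLocalRing.maximalIdeal R))
    (hm : IsLocalRing.maximalIdeal R ^ 6 ≤ Ideal.span {x}) :
    (∃ Φ : MvPowerSeries (Fin n) k →ₐ[k] R, Function.Surjective Φ) ∧
    ∀ Φ : MvPowerSeries (Fin n) k →ₐ[k] R, Function.Surjective Φ →
      Submodule.torsion R (Berger.UnivFiniteDifferentials Φ) ≠ ⊥ :=
  mainTheorem2_general hres.2 hGor n hedim hn x (hx.prop.1 (Ideal.mem_span_singleton_self x)) hm
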